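/- Let $\mathcal H$ be a separable infinite-dimensional complex Hilbert space and $\mathcal B(\mathcal H)$ the algebra of bounded linear operators on $\mathcal H$ with operator norm $\|\cdot\|$. A \emph{symmetrically normed ideal} is a two-sided ideal $\mathcal I\subseteq\mathcal B(\mathcal H)$ endowed with a norm $\|\cdot\|_{\mathcal I}$ for which $\mathcal I$ is a Banach space, such that $\|bxc\|_{\mathcal I}\le\|b\|\,\|x\|_{\mathcal I}\,\|c\|$ for all $x\in\mathcal I$ and $b,c\in\mathcal B(\mathcal H)$, and such that $\|p\|_{\mathcal I}=\|p\|=1$ for every rank-one orthogonal projection $p\in\mathcal I$. Let $\mathcal I$ be a symmetrically normed ideal that is separable with respect to $\|\cdot\|_{\mathcal I}$, and let $a\in\mathcal I$ be normal, that is, $aa^*=a^*a$. Then the full unitary orbit $$\mathcal O_{\mathcal B(\mathcal H)}(a)=\{uau^*\mid u\in\mathcal B(\mathcal H),\ uu^*=u^*u=1\}\subseteq\mathcal I$$ is closed in $(\mathcal I,\|\cdot\|_{\mathcal I})$ if and only if $a$ has finite rank. -/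

import Mathlib

open scoped InnerProductSpace

/-- A two-sided ideal of the algebra of bounded operators on `H` (automatically a complex linear
subspace), with a norm satisfying `‖a x b‖_J ≤ ‖a‖ ‖x‖_J ‖b‖`, normalized so that it agrees with
the operator norm on the rank-one projections `ξ ⊗ ξ̄` in the ideal. Completeness is not part of
this structure; it is added in `SymmetricallyNormedIdeal`. -/
structure SymmetricNormIdealData (H : Type*) [NormedAddCommGroup H] [InnerProductSpace ℂ H]
    [CompleteSpace H] where
  /-- the underlying set of operators -/
  carrier : Submodule ℂ (H →L[ℂ] H)
  mul_mul_mem : ∀ (a b : H →L[ℂ] H) {x : H →L[ℂ] H}, x ∈ carrier → a * x * b ∈ carrier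
  /-- the symmetric norm -/
  idealNorm : carrier → ℝ
  idealNorm_smul : ∀ (c : ℂ) (x : carrier), idealNorm (c • x) = ‖c‖ * idealNorm x
  idealNorm_add_le : ∀ x y : carrier, idealNorm (x + y) ≤ idealNorm x + idealNorm y
  idealNorm_nonneg : ∀ x : carrier, 0 ≤ idealNorm x
  eq_zero_of_idealNorm : ∀ x : carrier, idealNorm x = 0 → x = 0
  idealNorm_mul_mul_le : ∀ (a b : H →L[ℂ] H) (x : carrier),
    idealNorm ⟨a * (x : H →L[ℂ] H) * b, mul_mul_mem a b x.2⟩ ≤ ‖a‖ * idealNorm x * ‖b‖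
  idealNorm_rankOne : ∀ x : carrier, ∀ ξ : H, ‖ξ‖ = 1 →
    (x : H →L[ℂ] H) = InnerProductSpace.rankOne ℂ ξ ξ → idealNorm x = ‖(x : H →L[ℂ] H)‖

namespace SymmetricNormIdealData

variable {H : Type*} [NormedAddCommGroup H] [InnerProductSpace ℂ H] [CompleteSpace H]

/-- The ideal as a type of its own: a copy of the subspace `J.carrier` that carries the topology of
the symmetric norm `J.idealNorm` rather than that of the operator norm. -/
def Space (J : SymmetricNormIdealData H) : Type _ := J.carrier

instance (J : SymmetricNormIdealData H) : AddCommGroup J.Space :=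
  inferInstanceAs (AddCommGroup J.carrier)

instance (J : SymmetricNormIdealData H) : Module ℂ J.Space :=
  inferInstanceAs (Module ℂ J.carrier)

instance (J : SymmetricNormIdealData H) : Norm J.Space := ⟨J.idealNorm⟩

theorem normedSpaceCore (J : SymmetricNormIdealData H) : NormedSpace.Core ℂ J.Space where
  norm_nonneg := J.idealNorm_nonneg
  norm_smul := J.idealNorm_smul
  norm_triangle := J.idealNorm_add_le
  norm_eq_zero_iff x := by
    refine ⟨J.eq_zero_of_idealNorm x, ?_⟩
    rintro rfl
    have h := J.idealNorm_smul 0 0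
    rw [norm_zero, zero_mul, zero_smul] at h
    exact h

noncomputable instance (J : SymmetricNormIdealData H) : NormedAddCommGroup J.Space :=
  NormedAddCommGroup.ofCore J.normedSpaceCore

noncomputable instance (J : SymmetricNormIdealData H) : NormedSpace ℂ J.Space :=
  NormedSpace.ofCore J.normedSpaceCore

/-- The inclusion of the ideal in the algebra of bounded operators. -/
def incl (J : SymmetricNormIdealData H) : J.Space →ₗ[ℂ] (H →L[ℂ] H) := J.carrier.subtype

end SymmetricNormIdealData

/-- A symmetrically normed ideal of bounded operators on `H`: a two-sided ideal that is a Banach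
space for a normalized symmetric norm. -/
structure SymmetricallyNormedIdeal (H : Type*) [NormedAddCommGroup H] [InnerProductSpace ℂ H]
    [CompleteSpace H] extends SymmetricNormIdealData H where
  complete : CompleteSpace toSymmetricNormIdealData.Space

/-- The full unitary orbit `{u a u* | u unitary}` of a bounded operator `a`. -/
def fullUnitaryOrbit {H : Type*} [NormedAddCommGroup H] [InnerProductSpace ℂ H] [CompleteSpace H]
    (a : H →L[ℂ] H) : Set (H →L[ℂ] H) :=
  {b | ∃ u ∈ unitary (H →L[ℂ] H), b = u * a * star u}

/-- The full unitary orbit of an element of an ideal, as a subset of that ideal. -/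
def SymmetricNormIdealData.orbit {H : Type*} [NormedAddCommGroup H] [InnerProductSpace ℂ H]
    [CompleteSpace H] (J : SymmetricNormIdealData H) (a : J.Space) : Set J.Space :=
  J.incl ⁻¹' fullUnitaryOrbit (J.incl a)

/-- No part of the full orbit is lost by regarding it as a subset of the ideal. -/
theorem SymmetricNormIdealData.incl_image_orbit {H : Type*} [NormedAddCommGroup H]
    [InnerProductSpace ℂ H] [CompleteSpace H] (J : SymmetricNormIdealData H) (a : J.Space) :
    J.incl '' J.orbit a = fullUnitaryOrbit (J.incl a) := by
  apply Set.image_preimage_eq_of_subset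
  rintro b ⟨u, -, rfl⟩
  exact ⟨⟨_, J.mul_mul_mem u (star u) a.2⟩, rfl⟩

/-! If `a` has finite rank, its spectrum is finite, and the orbit of a normal element with finite
spectrum is norm closed in any C*-algebra; the inclusion of the ideal is continuous, so the orbit is
closed there too.

Separability of the ideal gives `e_k x e_k → x` in the ideal norm for the finite-rank coordinate
projections `e_k` (`cauchySeq_of_disjoint_additive`). Since an isometry `v` agrees on any
finite-dimensional subspace with some unitary, `v x v*` is then a limit of unitary conjugates of
`x`, and `x` a limit of unitary conjugates of `v x v*`. Injectivity is invariant along an orbit but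
not under this passage. For `a` injective, take `v` onto a hyperplane: `v a v*` has a kernel. For
`a` of infinite rank with a kernel, take `v` onto `(ker a)ᗮ`: `b = v* a v` is injective and `a = v b
v*`. In both cases the closure contains a point outside the orbit. -/

/-! ### Unitary orbits of normal elements with finite spectrum -/

open Polynomial in
theorem aeval_eq_aeval_of_eqOn_spectrum {A : Type*} [CStarAlgebra A] {a : A} (ha : IsStarNormal a)
    {p q : ℂ[X]} (h : ∀ z ∈ spectrum ℂ a, p.eval z = q.eval z) : aeval a p = aeval a q := by
  rw [← cfc_polynomial p a, ← cfc_polynomial q a]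
  exact cfc_congr h

open Polynomial in
theorem spectrum_subset_of_aeval_eq_zero {A : Type*} [CStarAlgebra A] {a : A}
    {p : ℂ[X]} (h : aeval a p = 0) : ∀ z ∈ spectrum ℂ a, p.eval z = 0 := by
  intro z hz
  have := spectrum.subset_polynomial_aeval a p ⟨z, hz, rfl⟩
  rw [h] at this
  have : Nontrivial A := by
    by_contra hn
    rw [not_nontrivial_iff_subsingleton] at hn
    simp [spectrum.of_subsingleton] at hz
  simpa using ‹eval z p ∈ spectrum ℂ (0 : A)›

/-- Polar decomposition: by Fuglede–Putnam `w` also intertwines the adjoints, so `w* w` commutes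
with `a`, and the unitary `w (w* w)^(-1/2)` still intertwines. -/
theorem exists_unitary_conj_of_semiconjBy {A : Type*} [CStarAlgebra A] {a b w : A}
    (ha : IsStarNormal a) (hb : IsStarNormal b) (hw : IsUnit w) (h : SemiconjBy w a b) :
    ∃ u ∈ unitary A, b = u * a * star u := by
  have h' : star w * b = a * star w := by
    have := (SemiconjBy.star_right ha hb h).eq
    simpa using (congrArg star this).symm
  have hc : Commute (star w * w) a := by
    change star w * w * a = a * (star w * w)
    rw [mul_assoc, h.eq, ← mul_assoc, h', mul_assoc]
  have hunit : IsUnit (star w * w) := hw.star.mul hw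
  have hsa : IsSelfAdjoint (star w * w) := .star_mul_self w
  have hpos : ∀ x ∈ spectrum ℝ (star w * w), 0 < x := fun x hx =>
    lt_of_le_of_ne (spectrum_star_mul_self_nonneg x hx)
      fun h0 => spectrum.zero_notMem ℝ hunit (h0 ▸ hx)
  set k := star w * w with hk
  set f : ℝ → ℝ := fun x => (√x)⁻¹
  have hf : ContinuousOn f (spectrum ℝ k) :=
    Real.continuous_sqrt.continuousOn.inv₀ fun x hx => (Real.sqrt_pos.2 (hpos x hx)).ne'
  set g := cfc f k with hg
  have hgsa : star g = g := (cfc_predicate f k : IsSelfAdjoint g)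
  have hga : Commute g a := hc.cfc_real f
  have hgk : g * k * g = 1 := by
    conv_lhs => rw [hg, ← cfc_id ℝ k]
    rw [cfc_id ℝ k]
    nth_rw 2 [← cfc_id ℝ k]
    rw [← cfc_mul f id k, ← cfc_mul _ f k, ← cfc_one ℝ k]
    refine cfc_congr fun x hx => ?_
    have := Real.sqrt_pos.2 (hpos x hx)
    have h2 := Real.mul_self_sqrt (hpos x hx).le
    simp only [f, id, Pi.one_apply]
    field_simp
    nlinarith
  have hgu : IsUnit g := by
    have hgk' : Commute g k := (Commute.refl k).cfc_real f
    refine ⟨⟨g, k * g, by rw [← mul_assoc, hgk], by rw [← hgk'.eq, hgk]⟩, rfl⟩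
  have hu1 : star (w * g) * (w * g) = 1 := by
    rw [star_mul, hgsa, ← hgk, hk]; noncomm_ring
  have hu2 : (w * g) * star (w * g) = 1 := by
    have := (hw.mul hgu)
    rw [← this.mul_left_inj, mul_assoc, hu1, mul_one, one_mul]
  refine ⟨w * g, ⟨hu1, hu2⟩, ?_⟩
  have : w * g * a = b * (w * g) := by rw [mul_assoc, hga.eq, ← mul_assoc, h.eq, mul_assoc]
  rw [this, mul_assoc, hu2, mul_one]

-- For `b` in the closure, the Lagrange polynomials of the spectrum of `a` give spectral projections
-- of `b` and of each `c` in the orbit. The sum `W c = ∑ ℓ_z(b) ℓ_z(c)` intertwines `c` with `b`,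
-- and `W b = 1`, so `W c` is invertible for `c` close to `b`.
open Polynomial Filter Topology in
theorem isClosed_unitary_conj_of_finite_spectrum {A : Type*} [CStarAlgebra A] {a : A}
    (ha : IsStarNormal a) (hfin : (spectrum ℂ a).Finite) :
    IsClosed {b : A | ∃ u ∈ unitary A, b = u * a * star u} := by
  classical
  set F := hfin.toFinset
  have hF {z : ℂ} : z ∈ F ↔ z ∈ spectrum ℂ a := hfin.mem_toFinset
  set O := {b : A | ∃ u ∈ unitary A, b = u * a * star u}
  set m : ℂ[X] := ∏ z ∈ F, (X - C z)
  have hm (z : ℂ) : m.eval z = 0 ↔ z ∈ F := by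
    simp [m, eval_prod, Finset.prod_eq_zero_iff, sub_eq_zero]
  have hma : aeval a m = 0 := by
    rw [← map_zero (aeval (R := ℂ) a)]
    exact aeval_eq_aeval_of_eqOn_spectrum ha fun z hz => by simp [(hm z).2 (hF.2 hz)]
  have hconj {u : A} (hu : u ∈ unitary A) (p : ℂ[X]) :
      aeval (u * a * star u) p = u * aeval a p * star u := by
    have := aeval_algHom_apply (Unitary.conjStarAlgAut ℂ A ⟨u, hu⟩ : A →⋆ₐ[ℂ] A).toAlgHom a p
    simpa [Unitary.conjStarAlgAut_apply] using this
  have hOn : ∀ b ∈ O, IsStarNormal b := by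
    rintro _ ⟨u, hu, rfl⟩
    refine ⟨?_⟩
    have h1 : star u * u = 1 := hu.1
    change star (u * a * star u) * (u * a * star u) = (u * a * star u) * star (u * a * star u)
    calc star (u * a * star u) * (u * a * star u)
        = u * (star a * (star u * u) * a) * star u := by simp; noncomm_ring
      _ = u * (a * (star u * u) * star a) * star u := by
        rw [h1, mul_one, mul_one, ha.star_comm_self.eq]
      _ = _ := by simp; noncomm_ring
  have hOm : ∀ b ∈ O, aeval b m = 0 := by
    rintro _ ⟨u, hu, rfl⟩
    simp [hconj hu, hma]
  refine isClosed_of_closure_subset fun b hb => ?_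
  -- Normality and annihilation by `m` are closed conditions, so they pass from the orbit to `b`.
  have hbn : IsStarNormal b := by
    have : IsClosed {b : A | star b * b = b * star b} :=
      isClosed_eq (by fun_prop) (by fun_prop)
    exact ⟨closure_minimal (fun c hc => (hOn c hc).star_comm_self) this hb⟩
  have hbm : aeval b m = 0 := by
    have : IsClosed {b : A | aeval b m = 0} :=
      isClosed_eq m.continuous_aeval continuous_const
    exact closure_minimal hOm this hb
  have key {c : A} (hc : IsStarNormal c) (hcm : aeval c m = 0) {p q : ℂ[X]}
      (h : ∀ z ∈ F, p.eval z = q.eval z) : aeval c p = aeval c q :=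
    aeval_eq_aeval_of_eqOn_spectrum hc fun z hz =>
      h z ((hm z).1 (spectrum_subset_of_aeval_eq_zero hcm z hz))
  set ℓ : ℂ → ℂ[X] := fun z => Lagrange.basis F id z
  have hℓ1 {z} (hz : z ∈ F) : (ℓ z).eval z = 1 :=
    Lagrange.eval_basis_self (v := id) Function.injective_id.injOn hz
  have hℓ0 {z y} (hz : y ∈ F) (h : z ≠ y) : (ℓ z).eval y = 0 :=
    Lagrange.eval_basis_of_ne (v := id) h hz
  have hℓX {c : A} (hc : IsStarNormal c) (hcm : aeval c m = 0) {z : ℂ} :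
      c * aeval c (ℓ z) = z • aeval c (ℓ z) ∧ aeval c (ℓ z) * c = z • aeval c (ℓ z) := by
    have h1 : aeval c (X * ℓ z) = aeval c (C z * ℓ z) := by
      refine key hc hcm fun y hy => ?_
      by_cases hzy : z = y
      · simp [hzy]
      · simp [hℓ0 hy hzy]
    have h2 := h1
    rw [mul_comm X] at h2
    simp only [map_mul, aeval_X, aeval_C, ← Algebra.smul_def] at h1 h2
    exact ⟨h1, h2⟩
  set W : A → A := fun c => ∑ z ∈ F, aeval b (ℓ z) * aeval c (ℓ z)
  have hWc : Continuous W :=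
    continuous_finsetSum _ fun z _ => continuous_const.mul (ℓ z).continuous_aeval
  have hWb : W b = 1 := by
    have : W b = aeval b (∑ z ∈ F, ℓ z * ℓ z) := by simp [W]
    rw [this, ← map_one (aeval (R := ℂ) b)]
    refine key hbn hbm fun y hy => ?_
    rw [eval_finsetSum, Finset.sum_eq_single_of_mem y hy]
    · simp [hℓ1 hy]
    · intro z _ hzy
      simp [hℓ0 hy hzy]
  have hnear : W ⁻¹' {x | IsUnit x} ∈ 𝓝 b :=
    hWc.continuousAt.preimage_mem_nhds (by
      rw [hWb]; exact Units.isOpen.mem_nhds isUnit_one)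
  obtain ⟨c, hcu, hcO⟩ := mem_closure_iff_nhds.1 hb _ hnear
  have hsc : SemiconjBy (W c) c b := by
    change (∑ z ∈ F, _) * c = b * ∑ z ∈ F, _
    rw [Finset.sum_mul, Finset.mul_sum]
    refine Finset.sum_congr rfl fun z _ => ?_
    rw [mul_assoc, (hℓX (hOn c hcO) (hOm c hcO)).2, ← mul_assoc, (hℓX hbn hbm).1,
      mul_smul_comm, smul_mul_assoc]
  obtain ⟨v, hv, hbv⟩ := exists_unitary_conj_of_semiconjBy (hOn c hcO) hbn hcu hsc
  obtain ⟨u, hu, rfl⟩ := hcO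
  exact ⟨v * u, mul_mem hv hu, by rw [hbv, star_mul]; noncomm_ring⟩

-- The minimal polynomial `q` of `a` restricted to its range kills only that range; the extra factor
-- `X` makes `q * X` annihilate `a`.
open Polynomial in
theorem finite_spectrum_of_finiteDimensional_range {E : Type*} [NormedAddCommGroup E]
    [InnerProductSpace ℂ E] [CompleteSpace E] (a : E →L[ℂ] E)
    (h : FiniteDimensional ℂ (LinearMap.range a.toLinearMap)) : (spectrum ℂ a).Finite := by
  let r := a.toLinearMap.rangeRestrict
  let f : Module.End ℂ (LinearMap.range a.toLinearMap) := r ∘ₗ Submodule.subtype _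
  let q := minpoly ℂ f
  have hq : q ≠ 0 := minpoly.ne_zero (Algebra.IsIntegral.isIntegral f)
  have hqa (p : ℂ[X]) (x : E) : aeval a p (a x) = (aeval f p (r x) : E) := by
    induction p using Polynomial.induction_on' with
    | add p q hp hq => simp [hp, hq]
    | monomial n c =>
      have (n : ℕ) : (a ^ n) (a x) = ((f ^ n) (r x) : E) := by
        induction n with
        | zero => rfl
        | succ n ih => rw [pow_succ', pow_succ', mul_apply_eq_comp, ih]; rfl
      simp [aeval_monomial, Algebra.algebraMap_eq_smul_one, this]
  have h0 : aeval a (q * X) = 0 := by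
    ext x
    simp [q, hqa]
  have h1 : q * X ≠ 0 := mul_ne_zero hq X_ne_zero
  refine (q * X).roots.toFinset.finite_toSet.subset fun z hz => ?_
  simpa [h1] using spectrum_subset_of_aeval_eq_zero h0 z hz

/-! ### Separable Hilbert spaces: bases and extension of isometries -/

theorem Orthonormal.countable_of_separableSpace {𝕜 E ι : Type*} [RCLike 𝕜] [NormedAddCommGroup E]
    [InnerProductSpace 𝕜 E] [TopologicalSpace.SeparableSpace E] {v : ι → E}
    (hv : Orthonormal 𝕜 v) : Countable ι := by
  obtain ⟨d, hd⟩ := TopologicalSpace.exists_dense_seq E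
  have h (i : ι) : ∃ n, dist (v i) (d n) < 1 / 2 :=
    (hd.exists_dist_lt (v i) (by norm_num))
  choose f hf using h
  refine Function.Injective.countable (f := f) fun i j hij => ?_
  by_contra hne
  have h1 : ‖v i - v j‖ ^ 2 = 2 := by
    rw [@norm_sub_sq 𝕜, hv.1, hv.1, hv.2 hne]
    norm_num
  have h2 : ‖v i - v j‖ < 1 := by
    rw [← dist_eq_norm]
    have h3 := hf i
    rw [hij] at h3
    have := dist_triangle_right (v i) (v j) (d (f j))
    linarith [hf j]
  nlinarith [norm_nonneg (v i - v j)]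

theorem nonempty_hilbertBasis_nat {E : Type*} [NormedAddCommGroup E] [InnerProductSpace ℂ E]
    [CompleteSpace E] [TopologicalSpace.SeparableSpace E] (hE : ¬ FiniteDimensional ℂ E) :
    Nonempty (HilbertBasis ℕ ℂ E) := by
  obtain ⟨w, b, -⟩ := exists_hilbertBasis ℂ E
  have : Countable w := b.orthonormal.countable_of_separableSpace
  have : Infinite w := by
    by_contra hfin
    rw [not_infinite_iff_finite] at hfin
    have := Fintype.ofFinite w
    exact hE b.toOrthonormalBasis.toBasis.finiteDimensional_of_finite
  have := Encodable.ofCountable w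
  have := Denumerable.ofEncodableOfInfinite w
  let e : ℕ ≃ w := (Denumerable.eqv w).symm
  refine ⟨HilbertBasis.mk (b.orthonormal.comp e e.injective) ?_⟩
  rw [e.surjective.range_comp, b.dense_span]

theorem nonempty_linearIsometryEquiv_of_infinite_dimensional {E F : Type*} [NormedAddCommGroup E]
    [InnerProductSpace ℂ E] [CompleteSpace E] [TopologicalSpace.SeparableSpace E]
    [NormedAddCommGroup F] [InnerProductSpace ℂ F] [CompleteSpace F]
    [TopologicalSpace.SeparableSpace F] (hE : ¬ FiniteDimensional ℂ E)
    (hF : ¬ FiniteDimensional ℂ F) : Nonempty (E ≃ₗᵢ[ℂ] F) := by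
  obtain ⟨b⟩ := nonempty_hilbertBasis_nat hE
  obtain ⟨c⟩ := nonempty_hilbertBasis_nat hF
  exact ⟨b.repr.trans c.repr.symm⟩

section

variable {H : Type*} [NormedAddCommGroup H] [InnerProductSpace ℂ H]

theorem not_finiteDimensional_orthogonal (hH : ¬ FiniteDimensional ℂ H)
    (V : Submodule ℂ H) [FiniteDimensional ℂ V] : ¬ FiniteDimensional ℂ Vᗮ := by
  intro h
  apply hH
  have : FiniteDimensional ℂ (V ⊔ Vᗮ : Submodule ℂ H) := inferInstance
  rw [V.sup_orthogonal_of_hasOrthogonalProjection] at this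
  exact Module.Finite.equiv (Submodule.topEquiv (R := ℂ) (M := H))

variable [CompleteSpace H] [TopologicalSpace.SeparableSpace H]

/-- `V` and `v(V)` both have infinite-dimensional complements, which are isometric; such an isometry
is glued to `v` on `V`. -/
theorem exists_linearIsometryEquiv_eqOn_of_finiteDimensional (hH : ¬ FiniteDimensional ℂ H)
    (v : H →ₗᵢ[ℂ] H) (V : Submodule ℂ H) [FiniteDimensional ℂ V] :
    ∃ u : H ≃ₗᵢ[ℂ] H, ∀ x ∈ V, u x = v x := by
  have : FiniteDimensional ℂ (V.map v.toLinearMap) := inferInstance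
  obtain ⟨w⟩ := nonempty_linearIsometryEquiv_of_infinite_dimensional
    (not_finiteDimensional_orthogonal hH V)
    (not_finiteDimensional_orthogonal hH (V.map v.toLinearMap))
  obtain ⟨e, he⟩ : ∃ e : V ≃ₗᵢ[ℂ] V.map v.toLinearMap, ∀ x, (e x : H) = v x :=
    ⟨{ V.equivMapOfInjective v.toLinearMap v.injective with
        norm_map' := fun x => v.norm_map x }, fun _ => rfl⟩
  refine ⟨(V.orthogonalDecomposition.trans (LinearIsometryEquiv.withLpProdCongr 2 e w)).trans
    (V.map v.toLinearMap).orthogonalDecomposition.symm, fun x hx => ?_⟩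
  have h1 : V.orthogonalProjectionOnto x = ⟨x, hx⟩ := Submodule.orthogonalProjectionOnto_mem_subspace_eq_self ⟨x, hx⟩
  have h2 : Vᗮ.orthogonalProjectionOnto x = 0 :=
    Submodule.orthogonalProjectionOnto_orthogonal_apply_eq_zero hx
  simp [h1, h2, he]

end

/-! ### Coordinate projections of a Hilbert basis -/

namespace HilbertBasis

theorem ext_basis {H : Type*} [NormedAddCommGroup H] [InnerProductSpace ℂ H]
    (b : HilbertBasis ℕ ℂ H) {f g : H →L[ℂ] H} (h : ∀ n, f (b n) = g (b n)) : f = g := by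
  have hd : Dense (Submodule.span ℂ (Set.range b) : Set H) :=
    Submodule.dense_iff_topologicalClosure_eq_top.2 b.dense_span
  refine ContinuousLinearMap.ext_on hd ?_
  rintro _ ⟨n, rfl⟩
  exact h n

variable {H : Type*} [NormedAddCommGroup H] [InnerProductSpace ℂ H] [CompleteSpace H]
  (b : HilbertBasis ℕ ℂ H)

/-- The orthogonal projection onto the closed span of the basis vectors with index in `S`. -/
noncomputable def proj (S : Set ℕ) : H →L[ℂ] H :=
  (Submodule.span ℂ (b '' S)).topologicalClosure.starProjection

theorem norm_proj_le (S : Set ℕ) : ‖b.proj S‖ ≤ 1 := Submodule.starProjection_norm_le _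

theorem proj_apply_of_mem {S : Set ℕ} {n : ℕ} (h : n ∈ S) : b.proj S (b n) = b n :=
  Submodule.starProjection_eq_self_iff.2 <|
    Submodule.le_topologicalClosure _ (Submodule.subset_span ⟨n, h, rfl⟩)

theorem proj_apply_of_notMem {S : Set ℕ} {n : ℕ} (h : n ∉ S) : b.proj S (b n) = 0 := by
  rw [proj, Submodule.starProjection_apply_eq_zero_iff, Submodule.orthogonal_closure,
    ← Submodule.span_singleton_le_iff_mem, ← Submodule.isOrtho_iff_le, Submodule.isOrtho_span]
  rintro _ rfl _ ⟨m, hm, rfl⟩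
  exact b.orthonormal.2 fun hnm => h (hnm ▸ hm)

open Classical in
theorem proj_apply (S : Set ℕ) (n : ℕ) : b.proj S (b n) = if n ∈ S then b n else 0 := by
  split_ifs with h
  exacts [b.proj_apply_of_mem h, b.proj_apply_of_notMem h]

theorem proj_mul_proj (S T : Set ℕ) : b.proj S * b.proj T = b.proj (S ∩ T) := by
  classical
  refine b.ext_basis fun n => ?_
  by_cases hS : n ∈ S <;> by_cases hT : n ∈ T <;> simp [proj_apply, hS, hT]

theorem proj_add_proj {S T : Set ℕ} (h : Disjoint S T) :
    b.proj S + b.proj T = b.proj (S ∪ T) := by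
  classical
  refine b.ext_basis fun n => ?_
  have : n ∈ S → n ∉ T := fun hn => Set.disjoint_left.1 h hn
  by_cases hS : n ∈ S <;> by_cases hT : n ∈ T <;> simp_all [proj_apply]

theorem proj_Iio_apply_mem (k : ℕ) (x : H) :
    b.proj (Set.Iio k) x ∈ Submodule.span ℂ (b '' Set.Iio k) := by
  have : FiniteDimensional ℂ (Submodule.span ℂ (b '' Set.Iio k)) :=
    FiniteDimensional.span_of_finite ℂ ((Set.finite_Iio k).image b)
  have h := Submodule.starProjection_apply_mem
    (Submodule.span ℂ (b '' Set.Iio k)).topologicalClosure x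
  exact (Submodule.closed_of_finiteDimensional _).submodule_topologicalClosure_eq.le h

theorem tendsto_proj_Iio (x : H) :
    Filter.Tendsto (fun k => b.proj (Set.Iio k) x) Filter.atTop (nhds x) := by
  refine Submodule.starProjection_tendsto_self _ (fun m n h => ?_) x ?_
  · exact Submodule.topologicalClosure_mono
      (Submodule.span_mono (Set.image_mono (Set.Iio_subset_Iio h)))
  · rw [← b.dense_span]
    refine Submodule.topologicalClosure_mono (Submodule.span_le.2 ?_)
    rintro _ ⟨n, rfl⟩
    exact Submodule.mem_iSup_of_mem (n + 1) <| Submodule.le_topologicalClosure _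
      (Submodule.subset_span ⟨n, Set.mem_Iio.2 n.lt_succ_self, rfl⟩)

end HilbertBasis

/-! ### Separability forces convergence of coordinate truncations -/

open Filter Topology

/-- If the sequence is not Cauchy, there are disjoint blocks `B j` with `‖T (B j) x‖ ≥ ε`. Unions of
blocks over arbitrary `A ⊆ ℕ` then give uncountably many points at mutual distance at least `ε`,
contradicting separability. -/
theorem cauchySeq_of_disjoint_additive {X : Type*} [NormedAddCommGroup X]
    [TopologicalSpace.SeparableSpace X] (T : Set ℕ → X →+ X)
    (hinter : ∀ S S' x, T S (T S' x) = T (S ∩ S') x) (hnorm : ∀ S x, ‖T S x‖ ≤ ‖x‖)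
    (hadd : ∀ S S', Disjoint S S' → ∀ x, T S x + T S' x = T (S ∪ S') x) (x : X) :
    CauchySeq fun k => T (Set.Iio k) x := by
  have hempty : T ∅ x = 0 := by simpa using hadd ∅ ∅ (Set.disjoint_empty _) x
  by_contra hc
  rw [Metric.cauchySeq_iff'] at hc
  push Not at hc
  obtain ⟨ε, hε, hc⟩ := hc
  have hblock (N : ℕ) : ∃ n, N < n ∧ ε ≤ ‖T (Set.Ico N n) x‖ := by
    obtain ⟨n, hn, h⟩ := hc N
    have hne : N ≠ n := by
      rintro rfl
      rw [dist_self] at h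
      exact h.not_gt hε
    refine ⟨n, lt_of_le_of_ne hn hne, ?_⟩
    have h2 := hadd (Set.Iio N) (Set.Ico N n)
      (Set.disjoint_left.2 fun i hi hi' => (Set.mem_Iio.1 hi).not_ge hi'.1) x
    rw [Set.Iio_union_Ico_eq_Iio hn] at h2
    rwa [dist_eq_norm, ← h2, add_sub_cancel_left] at h
  choose f hfN hfε using hblock
  let N : ℕ → ℕ := fun j => f^[j] 0
  have hNs (j : ℕ) : N (j + 1) = f (N j) := Function.iterate_succ_apply' f j 0
  have hN : Monotone N := monotone_nat_of_le_succ fun j => by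
    rw [hNs]; exact (hfN _).le
  have hdisj := hN.pairwise_disjoint_on_Ico_succ
  let B : ℕ → Set ℕ := fun j => Set.Ico (N j) (N (j + 1))
  have hB (j : ℕ) : ε ≤ ‖T (B j) x‖ := by
    simp only [B, hNs]; exact hfε _
  let U : Set ℕ → Set ℕ := fun A => ⋃ j ∈ A, B j
  have hU1 {i : ℕ} {A : Set ℕ} (h : i ∈ A) : B i ∩ U A = B i :=
    Set.inter_eq_left.2 (Set.subset_biUnion_of_mem (u := B) h)
  have hU0 {i : ℕ} {A : Set ℕ} (h : i ∉ A) : B i ∩ U A = ∅ := by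
    rw [← Set.disjoint_iff_inter_eq_empty]
    refine Set.disjoint_iUnion₂_right.2 fun j hj => hdisj ?_
    rintro rfl
    exact h hj
  obtain ⟨d, hd⟩ := TopologicalSpace.exists_dense_seq X
  -- With radius `ε / 2`, equal indices `g A = g A'` force a distance below `ε`, hence `A = A'`.
  choose g hg using fun A : Set ℕ => hd.exists_dist_lt (T (U A) x) (half_pos hε)
  have hsep {A A' : Set ℕ} {i : ℕ} (hi : i ∈ A) (hi' : i ∉ A') :
      ε ≤ dist (T (U A) x) (T (U A') x) := by
    have h1 := hnorm (B i) (T (U A) x - T (U A') x)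
    rw [map_sub, hinter, hinter, hU1 hi, hU0 hi', hempty, sub_zero] at h1
    rw [dist_eq_norm]
    exact (hB i).trans h1
  refine Function.cantor_injective g fun A A' hAA' => ?_
  have hlt : dist (T (U A) x) (T (U A') x) < ε := by
    have h1 := hg A
    rw [hAA'] at h1
    have := dist_triangle_right (T (U A) x) (T (U A') x) (d (g A'))
    linarith [hg A']
  ext i
  by_contra hne
  rcases not_iff.1 hne with h
  by_cases hi : i ∈ A
  · exact hlt.not_ge (hsep hi fun hi' => (h.2 hi') hi)
  · rw [dist_comm] at hlt
    exact hlt.not_ge (hsep (h.1 hi) hi)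

/-! ### Two-sided multiplication and continuity of the inclusion -/

namespace SymmetricNormIdealData

variable {H : Type*} [NormedAddCommGroup H] [InnerProductSpace ℂ H] [CompleteSpace H]
  (J : SymmetricNormIdealData H)

/-- The map `x ↦ b x c` on the ideal. -/
def mulMul (b c : H →L[ℂ] H) : J.Space →ₗ[ℂ] J.Space where
  toFun x := (⟨b * J.incl x * c, J.mul_mul_mem b c (Subtype.property (p := (· ∈ J.carrier)) x)⟩ :
    J.carrier)
  map_add' x y := Subtype.ext (by
    change b * J.incl (x + y) * c = b * J.incl x * c + b * J.incl y * c
    rw [map_add, mul_add, add_mul])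
  map_smul' z x := Subtype.ext (by
    change b * J.incl (z • x) * c = z • (b * J.incl x * c)
    rw [map_smul, mul_smul_comm, smul_mul_assoc])

theorem incl_mulMul (b c : H →L[ℂ] H) (x : J.Space) :
    J.incl (J.mulMul b c x) = b * J.incl x * c := rfl

theorem incl_injective : Function.Injective J.incl := Subtype.val_injective

theorem norm_mulMul_le (b c : H →L[ℂ] H) (x : J.Space) :
    ‖J.mulMul b c x‖ ≤ ‖b‖ * ‖x‖ * ‖c‖ := J.idealNorm_mul_mul_le b c x

theorem mulMul_mulMul (b c b' c' : H →L[ℂ] H) (x : J.Space) :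
    J.mulMul b c (J.mulMul b' c' x) = J.mulMul (b * b') (c' * c) x :=
  J.incl_injective (by simp only [incl_mulMul, mul_assoc])

theorem norm_mulMul_le_of_le_one {b c : H →L[ℂ] H} (hb : ‖b‖ ≤ 1) (hc : ‖c‖ ≤ 1)
    (x : J.Space) : ‖J.mulMul b c x‖ ≤ ‖x‖ := by
  refine (J.norm_mulMul_le b c x).trans ?_
  calc ‖b‖ * ‖x‖ * ‖c‖ ≤ 1 * ‖x‖ * 1 := by gcongr
    _ = ‖x‖ := by ring

theorem mulMul_one_one (x : J.Space) : J.mulMul 1 1 x = x :=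
  J.incl_injective (by simp [incl_mulMul])

/-- For a unit vector `ξ` and `r = ‖x ξ‖`, compressing `x` by rank-one operators gives `b x p = r²
p`, with `p` the projection onto `ξ` and `‖b‖ = r`. Normalization yields `r² ≤ r ‖x‖`. -/
theorem norm_incl_le (x : J.Space) : ‖J.incl x‖ ≤ ‖x‖ := by
  refine ContinuousLinearMap.opNorm_le_of_unit_norm (norm_nonneg x) fun ξ hξ => ?_
  rcases eq_or_ne (J.incl x ξ) 0 with h0 | h0
  · rw [h0, norm_zero]; exact norm_nonneg x
  set r : ℝ := ‖J.incl x ξ‖ with hr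
  have hr0 : r ≠ 0 := norm_ne_zero_iff.2 h0
  have hrc : (r : ℂ) ≠ 0 := by exact_mod_cast hr0
  set b := InnerProductSpace.rankOne ℂ ξ (J.incl x ξ) with hb
  set p := InnerProductSpace.rankOne ℂ ξ ξ with hp
  have hpn : ‖p‖ = 1 := by simp [hp, hξ]
  set y := ((r : ℂ)⁻¹ * (r : ℂ)⁻¹) • J.mulMul b p x with hy
  have hyp : J.incl y = p := by
    ext z
    simp [hy, incl_mulMul, hb, hp, ← hr, smul_smul]
    congr 1
    field_simp
  have h1 : ‖y‖ = 1 := by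
    have := J.idealNorm_rankOne y ξ hξ hyp
    change ‖y‖ = ‖J.incl y‖ at this
    rw [this, hyp, hpn]
  have h2 := J.norm_mulMul_le b p x
  have hbn : ‖b‖ = r := by simp [hb, hξ, hr]
  have hrn : ‖(r : ℂ)‖ = r := by simp [hr]
  rw [hpn, hbn, mul_one] at h2
  rw [hy, norm_smul, norm_mul, norm_inv, hrn] at h1
  have hrpos : 0 < r := lt_of_le_of_ne (norm_nonneg _) hr0.symm
  have h3 : ‖J.mulMul b p x‖ = r * r := by field_simp at h1; linarith
  rw [h3] at h2
  exact le_of_mul_le_mul_left h2 hrpos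

theorem continuous_incl : Continuous J.incl :=
  AddMonoidHomClass.continuous_of_bound J.incl 1 fun x => by simpa using J.norm_incl_le x

/-- Identifies a limit in the ideal norm, known to exist by completeness, from pointwise convergence
alone. -/
theorem tendsto_unique_of_tendsto_apply {u : ℕ → J.Space} {x y : J.Space}
    (h : Tendsto u atTop (𝓝 y)) (hx : ∀ ξ, Tendsto (fun k => J.incl (u k) ξ) atTop (𝓝 (J.incl x ξ))) :
    y = x := by
  refine J.incl_injective (ContinuousLinearMap.ext fun ξ => ?_)
  refine tendsto_nhds_unique ?_ (hx ξ)
  exact ((ContinuousLinearMap.apply ℂ H ξ).continuous.comp J.continuous_incl).continuousAt.tendsto.comp h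

end SymmetricNormIdealData

/-! ### Approximating conjugation by an isometry with unitary conjugations -/

namespace SymmetricallyNormedIdeal

variable {H : Type*} [NormedAddCommGroup H] [InnerProductSpace ℂ H] [CompleteSpace H]
  (I : SymmetricallyNormedIdeal H) [TopologicalSpace.SeparableSpace I.Space]

theorem tendsto_mul_proj (b : HilbertBasis ℕ ℂ H) (x : I.Space) :
    Tendsto (fun k => I.mulMul 1 (b.proj (Set.Iio k)) x) atTop (𝓝 x) := by
  have := I.complete
  have h1 : ‖(1 : H →L[ℂ] H)‖ ≤ 1 := ContinuousLinearMap.norm_id_le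
  have hc := cauchySeq_of_disjoint_additive (X := I.Space)
    (fun S => (I.mulMul 1 (b.proj S)).toAddMonoidHom)
    (fun S S' y => by
      simp [SymmetricNormIdealData.mulMul_mulMul, HilbertBasis.proj_mul_proj, Set.inter_comm])
    (fun S y => I.norm_mulMul_le_of_le_one h1 (b.norm_proj_le S) y)
    (fun S S' h y => I.incl_injective (by
      simp [SymmetricNormIdealData.incl_mulMul, ← b.proj_add_proj h, mul_add])) x
  obtain ⟨y, hy⟩ := cauchySeq_tendsto_of_complete hc
  have hyx : y = x := I.tendsto_unique_of_tendsto_apply hy fun ξ => by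
    simpa [SymmetricNormIdealData.incl_mulMul, Function.comp_def] using
      ((I.incl x).continuous.tendsto ξ).comp (b.tendsto_proj_Iio ξ)
  exact hyx ▸ hy

theorem tendsto_proj_mul (b : HilbertBasis ℕ ℂ H) (x : I.Space) :
    Tendsto (fun k => I.mulMul (b.proj (Set.Iio k)) 1 x) atTop (𝓝 x) := by
  have := I.complete
  have h1 : ‖(1 : H →L[ℂ] H)‖ ≤ 1 := ContinuousLinearMap.norm_id_le
  have hc := cauchySeq_of_disjoint_additive (X := I.Space)
    (fun S => (I.mulMul (b.proj S) 1).toAddMonoidHom)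
    (fun S S' y => by
      simp [SymmetricNormIdealData.mulMul_mulMul, HilbertBasis.proj_mul_proj])
    (fun S y => I.norm_mulMul_le_of_le_one (b.norm_proj_le S) h1 y)
    (fun S S' h y => I.incl_injective (by
      simp [SymmetricNormIdealData.incl_mulMul, ← b.proj_add_proj h, add_mul])) x
  obtain ⟨y, hy⟩ := cauchySeq_tendsto_of_complete hc
  have hyx : y = x := I.tendsto_unique_of_tendsto_apply hy fun ξ => by
    simpa [SymmetricNormIdealData.incl_mulMul] using b.tendsto_proj_Iio (I.incl x ξ)
  exact hyx ▸ hy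

theorem tendsto_proj_mul_proj (b : HilbertBasis ℕ ℂ H) (x : I.Space) :
    Tendsto (fun k => I.mulMul (b.proj (Set.Iio k)) (b.proj (Set.Iio k)) x) atTop (𝓝 x) := by
  have h1 : ‖(1 : H →L[ℂ] H)‖ ≤ 1 := ContinuousLinearMap.norm_id_le
  rw [tendsto_iff_norm_sub_tendsto_zero]
  have hl := tendsto_iff_norm_sub_tendsto_zero.1 (I.tendsto_proj_mul b x)
  have hr := tendsto_iff_norm_sub_tendsto_zero.1 (I.tendsto_mul_proj b x)
  refine squeeze_zero (fun k => norm_nonneg _) (fun k => ?_) (by simpa using hr.add hl)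
  set e := b.proj (Set.Iio k)
  have : I.mulMul e e x - x =
      I.mulMul e 1 (I.mulMul 1 e x - x) + (I.mulMul e 1 x - x) := by
    rw [map_sub, I.mulMul_mulMul, mul_one]; abel
  rw [this]
  exact (norm_add_le _ _).trans
    (add_le_add_left (I.norm_mulMul_le_of_le_one (b.norm_proj_le _) h1 _) _)

/-- With `u k` equal to `v` on the first `k` basis vectors, both conjugations agree on `e x e`; the
error is at most `2 ‖e x e - x‖`. -/
theorem exists_unitary_tendsto_isometry_conj [TopologicalSpace.SeparableSpace H]
    (hH : ¬ FiniteDimensional ℂ H) (v : H →ₗᵢ[ℂ] H) (x : I.Space) :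
    ∃ u : ℕ → H →L[ℂ] H, (∀ k, u k ∈ unitary (H →L[ℂ] H)) ∧
      Tendsto (fun k => I.mulMul (u k) (star (u k)) x) atTop
        (𝓝 (I.mulMul v.toContinuousLinearMap (star v.toContinuousLinearMap) x)) := by
  obtain ⟨b⟩ := nonempty_hilbertBasis_nat hH
  set V := v.toContinuousLinearMap
  have hV : ‖V‖ ≤ 1 := v.norm_toContinuousLinearMap_le
  have hVs : ‖star V‖ ≤ 1 := (norm_star V).trans_le hV
  have hu (k : ℕ) : ∃ u ∈ unitary (H →L[ℂ] H),
      u * b.proj (Set.Iio k) = V * b.proj (Set.Iio k) := by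
    have : FiniteDimensional ℂ (Submodule.span ℂ (b '' Set.Iio k)) :=
      FiniteDimensional.span_of_finite ℂ ((Set.finite_Iio k).image b)
    obtain ⟨u, hu⟩ := exists_linearIsometryEquiv_eqOn_of_finiteDimensional hH v
      (Submodule.span ℂ (b '' Set.Iio k))
    exact ⟨_, (Unitary.linearIsometryEquiv.symm u).2,
      ContinuousLinearMap.ext fun ξ => hu _ (b.proj_Iio_apply_mem k ξ)⟩
  choose u huU hue using hu
  refine ⟨u, huU, ?_⟩
  have hun (k : ℕ) : ‖u k‖ ≤ 1 :=
    ContinuousLinearMap.opNorm_le_bound _ zero_le_one fun ξ => by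
      rw [one_mul]; exact (Unitary.norm_map ⟨u k, huU k⟩ ξ).le
  rw [tendsto_iff_norm_sub_tendsto_zero]
  have hx := tendsto_iff_norm_sub_tendsto_zero.1 (I.tendsto_proj_mul_proj b x)
  refine squeeze_zero (fun k => norm_nonneg _) (fun k => ?_) (by simpa using hx.add hx)
  set e := b.proj (Set.Iio k) with he
  have hes : star e = e := (isSelfAdjoint_starProjection _).star_eq
  have hmid : I.mulMul (u k) (star (u k)) (I.mulMul e e x) =
      I.mulMul V (star V) (I.mulMul e e x) := by
    have : e * star (u k) = e * star V := by
      have := congrArg star (hue k)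
      rwa [star_mul, star_mul, ← he, hes] at this
    rw [I.mulMul_mulMul, I.mulMul_mulMul, hue, this]
  have : I.mulMul (u k) (star (u k)) x - I.mulMul V (star V) x =
      I.mulMul V (star V) (I.mulMul e e x - x) - I.mulMul (u k) (star (u k)) (I.mulMul e e x - x) := by
    rw [map_sub, map_sub, hmid]; abel
  rw [this]
  exact (norm_sub_le _ _).trans (add_le_add (I.norm_mulMul_le_of_le_one hV hVs _)
    (I.norm_mulMul_le_of_le_one (hun k) ((norm_star _).trans_le (hun k)) _))

end SymmetricallyNormedIdeal

/-! ### Injectivity along orbits and the two implications -/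

section

variable {H : Type*} [NormedAddCommGroup H] [InnerProductSpace ℂ H] [CompleteSpace H]

theorem LinearIsometry.star_mul_self (v : H →ₗᵢ[ℂ] H) :
    star v.toContinuousLinearMap * v.toContinuousLinearMap = 1 :=
  (ContinuousLinearMap.norm_map_iff_adjoint_comp_self _).1 v.norm_map

theorem injective_conj_iff_of_mem_unitary {a u : H →L[ℂ] H} (hu : u ∈ unitary (H →L[ℂ] H)) :
    Function.Injective (u * a * star u) ↔ Function.Injective a := by
  have h : ⇑(u * a * star u) =
      Unitary.linearIsometryEquiv ⟨u, hu⟩ ∘ a ∘ Unitary.linearIsometryEquiv (star ⟨u, hu⟩) := rfl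
  rw [h, EquivLike.comp_injective, EquivLike.injective_comp]

theorem exists_linearIsometry_range_eq [TopologicalSpace.SeparableSpace H]
    (hH : ¬ FiniteDimensional ℂ H) (K : Submodule ℂ H) [CompleteSpace K]
    (hK : ¬ FiniteDimensional ℂ K) :
    ∃ v : H →ₗᵢ[ℂ] H, ∀ y, y ∈ K ↔ ∃ x, v x = y := by
  obtain ⟨e⟩ := nonempty_linearIsometryEquiv_of_infinite_dimensional hH hK
  refine ⟨K.subtypeₗᵢ.comp e.toLinearIsometry, fun y => ⟨fun hy => ⟨e.symm ⟨y, hy⟩, by simp⟩, ?_⟩⟩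
  rintro ⟨x, rfl⟩
  exact (e x).2

end

namespace SymmetricallyNormedIdeal

variable {H : Type*} [NormedAddCommGroup H] [InnerProductSpace ℂ H] [CompleteSpace H]
  (I : SymmetricallyNormedIdeal H)

theorem isClosed_orbit_of_finiteDimensional_range {a : I.Space} (ha : IsStarNormal (I.incl a))
    (h : FiniteDimensional ℂ (LinearMap.range (I.incl a).toLinearMap)) :
    IsClosed (I.orbit a) :=
  (isClosed_unitary_conj_of_finite_spectrum ha
    (finite_spectrum_of_finiteDimensional_range _ h)).preimage I.continuous_incl

variable [TopologicalSpace.SeparableSpace H] [TopologicalSpace.SeparableSpace I.Space]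

theorem isometry_conj_mem_closure_orbit (hH : ¬ FiniteDimensional ℂ H) (v : H →ₗᵢ[ℂ] H)
    (x : I.Space) :
    I.mulMul v.toContinuousLinearMap (star v.toContinuousLinearMap) x ∈ closure (I.orbit x) := by
  obtain ⟨u, hu, hlim⟩ := I.exists_unitary_tendsto_isometry_conj hH v x
  exact mem_closure_of_tendsto hlim (.of_forall fun k => ⟨u k, hu k, rfl⟩)

theorem mem_closure_orbit_isometry_conj (hH : ¬ FiniteDimensional ℂ H) (v : H →ₗᵢ[ℂ] H)
    (x : I.Space) :
    x ∈ closure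
      (I.orbit (I.mulMul v.toContinuousLinearMap (star v.toContinuousLinearMap) x)) := by
  obtain ⟨u, hu, hlim⟩ := I.exists_unitary_tendsto_isometry_conj hH v x
  set y := I.mulMul v.toContinuousLinearMap (star v.toContinuousLinearMap) x
  have hun (k : ℕ) : ‖u k‖ ≤ 1 :=
    ContinuousLinearMap.opNorm_le_bound _ zero_le_one fun ξ => by
      rw [one_mul]; exact (Unitary.norm_map ⟨u k, hu k⟩ ξ).le
  refine mem_closure_of_tendsto (b := atTop) (f := fun k => I.mulMul (star (u k)) (star (star (u k))) y) ?_
    (.of_forall fun k => ⟨star (u k), Unitary.star_mem (hu k), rfl⟩)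
  rw [tendsto_iff_norm_sub_tendsto_zero]
  refine squeeze_zero (fun k => norm_nonneg _) (fun k => ?_)
    (tendsto_iff_norm_sub_tendsto_zero.1 hlim)
  -- Conjugating back by the contraction `star (u k)` turns `u_k x u_k* → y` into `u_k* y u_k → x`.
  have hx : x = I.mulMul (star (u k)) (u k) (I.mulMul (u k) (star (u k)) x) := by
    rw [I.mulMul_mulMul, (hu k).1, I.mulMul_one_one]
  conv_lhs => rw [hx, star_star, ← map_sub]
  rw [norm_sub_rev (I.mulMul (u k) (star (u k)) x)]
  exact I.norm_mulMul_le_of_le_one ((norm_star _).trans_le (hun k)) (hun k) _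

theorem not_isClosed_orbit_of_injective (hH : ¬ FiniteDimensional ℂ H) {a : I.Space}
    (ha : Function.Injective (I.incl a)) : ¬ IsClosed (I.orbit a) := by
  intro hcl
  have : Nontrivial H := by
    by_contra h
    rw [not_nontrivial_iff_subsingleton] at h
    exact hH inferInstance
  obtain ⟨ξ, hξ⟩ := exists_ne (0 : H)
  obtain ⟨v, hv⟩ := exists_linearIsometry_range_eq hH (ℂ ∙ ξ)ᗮ
    (not_finiteDimensional_orthogonal hH _)
  set V := v.toContinuousLinearMap
  obtain ⟨u, hu, h⟩ := hcl.closure_eq ▸ I.isometry_conj_mem_closure_orbit hH v a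
  have hinj := (injective_conj_iff_of_mem_unitary hu).2 ha
  rw [← h, I.incl_mulMul] at hinj
  refine hξ (hinj ?_)
  have hξV : star V ξ = 0 := by
    refine ext_inner_right ℂ fun y => ?_
    rw [ContinuousLinearMap.star_eq_adjoint, ContinuousLinearMap.adjoint_inner_left,
      inner_zero_left]
    exact Submodule.mem_orthogonal_singleton_iff_inner_right.1 ((hv (v y)).2 ⟨y, rfl⟩)
  simp [V, hξV]

theorem not_isClosed_orbit_of_not_injective (hH : ¬ FiniteDimensional ℂ H) {a : I.Space}
    (ha : IsStarNormal (I.incl a))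
    (hrange : ¬ FiniteDimensional ℂ (LinearMap.range (I.incl a).toLinearMap))
    (hinj : ¬ Function.Injective (I.incl a)) : ¬ IsClosed (I.orbit a) := by
  intro hcl
  set A := I.incl a with hA
  set K : Submodule ℂ H := (LinearMap.ker A.toLinearMap)ᗮ with hKdef
  have hsK (x : H) : star A x ∈ K := by
    refine (Submodule.mem_orthogonal' _ _).2 fun z hz => ?_
    rw [ContinuousLinearMap.star_eq_adjoint, ContinuousLinearMap.adjoint_inner_left]
    have : A z = 0 := hz
    rw [this, inner_zero_right]
  -- Normality enters here: the orthogonal complement of the range is the kernel of `A` itself.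
  have hK (x : H) : A x ∈ K := by
    rw [hKdef]
    have := ContinuousLinearMap.IsStarNormal.orthogonal_range ha
    erw [← this]
    exact Submodule.le_orthogonal_orthogonal _ ⟨x, rfl⟩
  have hKinf : ¬ FiniteDimensional ℂ K := fun h =>
    hrange (Submodule.finiteDimensional_of_le (by rintro _ ⟨x, rfl⟩; exact hK x))
  obtain ⟨v, hv⟩ := exists_linearIsometry_range_eq hH K hKinf
  set V := v.toContinuousLinearMap
  have hVV : star V * V = 1 := v.star_mul_self
  have hproj {y : H} (hy : y ∈ K) : V (star V y) = y := by
    obtain ⟨x, rfl⟩ := (hv y).1 hy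
    exact congrArg V (DFunLike.congr_fun hVV x)
  -- `V * star V` fixes `K`, which contains the ranges of `A` and `star A`, so compressing `A` to
  -- `K` loses nothing.
  have hl : V * star V * A = A := ContinuousLinearMap.ext fun x => hproj (hK x)
  have hr : A * (V * star V) = A := by
    have : V * star V * star A = star A := ContinuousLinearMap.ext fun x => hproj (hsK x)
    simpa using congrArg star this
  set b := I.mulMul (star V) V a
  have hab : I.mulMul V (star V) b = a := by
    rw [I.mulMul_mulMul]
    exact I.incl_injective (by rw [I.incl_mulMul, ← hA, hl, hr])
  have hb := I.mem_closure_orbit_isometry_conj hH v b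
  rw [hab, hcl.closure_eq] at hb
  obtain ⟨u, hu, h⟩ := hb
  refine hinj ((injective_conj_iff_of_mem_unitary hu).1 ?_)
  rw [← hA] at h
  rw [← h, I.incl_mulMul, ← hA]
  -- The compression is injective: a vector of its kernel is sent by `v` into both `ker A` and its
  -- orthogonal complement.
  refine (injective_iff_map_eq_zero (star V * A * V)).2 fun x hx => ?_
  have h0 : A (V x) = 0 := by
    rw [← hproj (hK (V x))]
    exact (congrArg V hx).trans (map_zero V)
  have h1 : v x = 0 := Submodule.disjoint_def.1
    (Submodule.orthogonal_disjoint (LinearMap.ker A.toLinearMap)) _ h0 ((hv _).2 ⟨x, rfl⟩)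
  exact v.injective (h1.trans (map_zero v).symm)

end SymmetricallyNormedIdeal

theorem mainTheorem7 {H : Type*} [NormedAddCommGroup H] [InnerProductSpace ℂ H] [CompleteSpace H]
    [TopologicalSpace.SeparableSpace H] (hH : ¬ FiniteDimensional ℂ H)
    (I : SymmetricallyNormedIdeal H) (hI : TopologicalSpace.SeparableSpace I.Space)
    (a : I.Space) (ha : IsStarNormal (I.incl a)) :
    IsClosed (I.orbit a) ↔ FiniteDimensional ℂ (LinearMap.range (I.incl a).toLinearMap) := by
  refine ⟨fun hcl => ?_, I.isClosed_orbit_of_finiteDimensional_range ha⟩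
  by_contra hrange
  by_cases hinj : Function.Injective (I.incl a)
  · exact I.not_isClosed_orbit_of_injective hH hinj hcl
  · exact I.not_isClosed_orbit_of_not_injective hH ha hrange hinj hcl
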